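/- **Setting.** Fix $n\in\mathbb N$ and constants $T,M,\delta,\tilde C_U>0$. Let $\tilde\Omega\subset\mathbb R^n$ be open and bounded, $\Omega\subseteq\tilde\Omega$ open and convex, $x_\Omega\in\Omega$, and put $p(x)=\operatorname{dist}(x,\Omega)$ and $\tilde\Omega(t)=\{x:\operatorname{dist}(x,\tilde\Omega)\le Mt\}$. Elements of $W^{k,\infty}$, $k\ge1$, are identified with their continuous representatives. *Controls.* $\tilde{\mathcal A}$ is the set of fields $a\in W^{3,\infty}(\mathbb R^n;\mathbb R^n)\cap H^1(\mathbb R^n;\mathbb R^n)$ with $\max\{\|a\|_{W^{3,\infty}},\|a\|_{H^1}\}\le M$, and $\mathcal A$ is the set of $\alpha\in L^2([0,T],W^{3,\infty}\cap H^1)$ with $\alpha(\cdot,s)\in\tilde{\mathcal A}$ for a.e. $s\in[0,T]$. *Evolution.* For $\alpha\in\mathcal A$ and $t\in[0,T]$ let $\Phi_{t,s}$, $s\in[t,T]$, be the flow of $\alpha$: $\Phi_{t,s}(x)=x+\int_t^s\alpha(\Phi_{t,r}(x),r)\,dr$, with inverse $\Psi_{t,s}=\Phi_{t,s}^{-1}$.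 The solution of $\partial_s m+\operatorname{div}(\alpha m)=0$, $m(\cdot,t)=\bar m$, is $$m(x,s;\alpha,\bar m,t)=\frac{\bar m(\Psi_{t,s}(x))}{\det D\Phi_{t,s}(\Psi_{t,s}(x))},\qquad s\in[t,T].$$ *State sets.* For $t\in(0,T]$, $X(t)$ is the set of $\bar m\in W^{2,\infty}(\mathbb R^n)$ with $\operatorname{supp}\bar m\subseteq\tilde\Omega(t)$ and $\|m(\cdot,s;\alpha,\bar m,t)\|_{W^{2,\infty}}\le\tilde C_U$ for all $s\in[t,T]$ and $\alpha\in\mathcal A$. With $\langle p,m\rangle=\int_{\tilde\Omega(T)}p\,m\,dx$, put $$X_c(t)=\{m\in X(t):\langle p,m\rangle<\delta\},\qquad \bar X_c(t)=\{m\in X(t):\langle p,m\rangle\le\delta\}.$$ *Pushback control.* Let $\rho>0$ and let $\phi\in C^\infty(\mathbb R^n)$ satisfy $\phi=1$ on $\overline{\tilde\Omega(T)}$ and $\phi(x)=0$ whenever $\operatorname{dist}(x,\tilde\Omega(T))\ge\rho$. Let $\bar M>0$ be such that $a_p(x):=\bar M\phi(x)(x_\Omega-x)$ defines an element $a_p\in\tilde{\mathcal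 A}$. **Lemma.** There is a constant $B>0$ such that for every non-negative $\bar m\in\bar X_c(T)$, every $\bar t\in[0,T)$, every $\zeta\in(0,1]$ and every $\varepsilon\in(0,\min\{B,T-\bar t\}]$, $$\bar X_c(T)\cap B_{L^2}\bigl(m(\cdot,\bar t+\varepsilon;\zeta a_p,\bar m,\bar t),\,\zeta\varepsilon B\bigr)\subseteq X_c(T),$$ where $B_{L^2}(m_0,r)=\{m:\|m-m_0\|_{L^2(\mathbb R^n)}<r\}$. That is, every $\tilde m\in\bar X_c(T)$ with $\|\tilde m-m(\cdot,\bar t+\varepsilon;\zeta a_p,\bar m,\bar t)\|_{L^2}<\zeta\varepsilon B$ satisfies $\langle p,\tilde m\rangle<\delta$. -/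

import Mathlib

open MeasureTheory Set Filter Topology
open scoped ENNReal ContDiff

/-- The Euclidean space `ℝⁿ`. -/
abbrev Rn (n : ℕ) : Type := EuclideanSpace ℝ (Fin n)

noncomputable section

/-! ### Sobolev norms through weak derivatives -/

/-- `g` is the weak (distributional) derivative of order `j` of `f : ℝⁿ → F`, viewed as a field of
`j`-linear maps: for every test function `φ` and all directions `v₁, …, v_j`,
`∫ (D^j φ)(v₁, …, v_j) f = (-1)^j ∫ φ g(v₁, …, v_j)`. -/
def HasWeakDeriv {n : ℕ} {F : Type*} [NormedAddCommGroup F] [NormedSpace ℝ F] (j : ℕ)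
    (f : Rn n → F) (g : Rn n → ContinuousMultilinearMap ℝ (fun _ : Fin j => Rn n) F) : Prop :=
  LocallyIntegrable f volume ∧ LocallyIntegrable g volume ∧
    ∀ φ : Rn n → ℝ, ContDiff ℝ ∞ φ → HasCompactSupport φ → ∀ v : Fin j → Rn n,
      ∫ x, (iteratedFDeriv ℝ j φ x v) • f x = (-1 : ℝ) ^ j • ∫ x, φ x • g x v

/-- The norm `‖f‖_{W^{k,∞}} = max_{j ≤ k} ess sup |D^j f|` (operator norms of the `j`-linear maps
`D^j f`). Weak derivatives are unique up to null sets, so the infimum only serves to pick them; it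
is `∞` when some weak derivative of order at most `k` does not exist. -/
def wInftyNorm {n : ℕ} {F : Type*} [NormedAddCommGroup F] [NormedSpace ℝ F] (k : ℕ)
    (f : Rn n → F) : ℝ≥0∞ :=
  ⨅ (D : ∀ j : ℕ, Rn n → ContinuousMultilinearMap ℝ (fun _ : Fin j => Rn n) F)
    (_ : ∀ j ≤ k, HasWeakDeriv j f (D j)),
    (Finset.range (k + 1)).sup fun j => eLpNorm (D j) ⊤ volume

/-- The norm `‖f‖_{H¹} = (∫ |f|² + ∑ᵢ ∫ |∂ᵢ f|²)^{1/2}`, with weak partial derivatives; it is `∞`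
when the weak gradient does not exist. -/
def hOneNorm {n : ℕ} {F : Type*} [NormedAddCommGroup F] [NormedSpace ℝ F]
    (f : Rn n → F) : ℝ≥0∞ :=
  ⨅ (D : Rn n → ContinuousMultilinearMap ℝ (fun _ : Fin 1 => Rn n) F)
    (_ : HasWeakDeriv 1 f D),
    (eLpNorm f 2 volume ^ 2 +
      ∑ i : Fin n, eLpNorm (fun x => D x fun _ => EuclideanSpace.single i (1 : ℝ)) 2 volume ^ 2)
        ^ (1 / 2 : ℝ)

/-! ### Velocity fields and controls

Elements of `W^{k,∞}` with `k ≥ 1` are identified with their continuous representatives. -/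

/-- The norm of `W^{3,∞}(ℝⁿ;ℝⁿ) ∩ H¹(ℝⁿ;ℝⁿ)`. -/
def fieldNorm {n : ℕ} (a : Rn n → Rn n) : ℝ≥0∞ := max (wInftyNorm 3 a) (hOneNorm a)

/-- The space `W^{3,∞}(ℝⁿ;ℝⁿ) ∩ H¹(ℝⁿ;ℝⁿ)`. -/
def fieldSpace (n : ℕ) : Set (Rn n → Rn n) := {a | Continuous a ∧ fieldNorm a < ⊤}

/-- The set `Ã` of fields `a` with `max {‖a‖_{W^{3,∞}}, ‖a‖_{H¹}} ≤ M`. -/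
def admissibleFields (n : ℕ) (M : ℝ) : Set (Rn n → Rn n) :=
  {a | a ∈ fieldSpace n ∧ max (wInftyNorm 3 a) (hOneNorm a) ≤ ENNReal.ofReal M}

/-- The set `𝒜` of controls: `α ∈ L²([0,T], W^{3,∞} ∩ H¹)` (strongly measurable with square
integrable norm) such that `α(·,s) ∈ Ã` for a.e. `s ∈ [0,T]`. -/
def admissibleControls (n : ℕ) (T M : ℝ) : Set (ℝ → Rn n → Rn n) :=
  {α | (∃ σ : ℕ → SimpleFunc ℝ (Rn n → Rn n), (∀ k s, σ k s ∈ fieldSpace n) ∧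
          ∀ᵐ s ∂(volume.restrict (Icc 0 T)),
            Tendsto (fun k => fieldNorm (σ k s - α s)) atTop (𝓝 0)) ∧
        (∫⁻ s in Icc 0 T, fieldNorm (α s) ^ 2) < ⊤ ∧
        ∀ᵐ s ∂(volume.restrict (Icc 0 T)), α s ∈ admissibleFields n M}

/-! ### Flow and evolution of densities -/

/-- `γ` solves `γ' = α(γ, s)` on `[t,T]` with `γ(t) = x`, in the sense of Carathéodory. -/
def IsTrajectory {n : ℕ} (T : ℝ) (α : ℝ → Rn n → Rn n) (t : ℝ) (x : Rn n) (γ : ℝ → Rn n) : Prop :=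
  ContinuousOn γ (Icc t T) ∧
    ∀ s ∈ Icc t T, IntervalIntegrable (fun r => α r (γ r)) volume t s ∧
      γ s = x + ∫ r in t..s, α r (γ r)

open Classical in
/-- The flow `Φ(x,s,t) = Φ_{t,s}(x)`, for `s ∈ [t,T]`: the position at time `s` of the particle that
is at `x` at time `t`. (The second branch is a junk value; for controls in `𝒜` the trajectory exists
and is unique on `[t,T]`.) -/
def flow {n : ℕ} (T : ℝ) (α : ℝ → Rn n → Rn n) (t s : ℝ) (x : Rn n) : Rn n :=
  if h : ∃ γ, IsTrajectory T α t x γ then h.choose s else x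

/-- The inverse flow `Ψ_{t,s} = Φ_{t,s}⁻¹`. -/
def flowInv {n : ℕ} (T : ℝ) (α : ℝ → Rn n → Rn n) (t s : ℝ) : Rn n → Rn n :=
  Function.invFun (flow T α t s)

/-- The solution `m(x,s;α,m̄,t) = m̄(Ψ_{t,s}(x)) / det DΦ_{t,s}(Ψ_{t,s}(x))` of the continuity
equation `∂ₛ m + div(α m) = 0` with `m(·,t) = m̄`. -/
def evolve {n : ℕ} (T : ℝ) (α : ℝ → Rn n → Rn n) (mbar : Rn n → ℝ) (t s : ℝ) (x : Rn n) : ℝ :=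
  mbar (flowInv T α t s x) / (fderiv ℝ (flow T α t s) (flowInv T α t s x)).det

/-! ### The invariant set and the state constraint -/

/-- `Ω̃(t) = {x : dist(x, Ω̃) ≤ M t}`. -/
def enlarged {n : ℕ} (M : ℝ) (Om' : Set (Rn n)) (t : ℝ) : Set (Rn n) :=
  {x | Metric.infDist x Om' ≤ M * t}

/-- The set `X(t)`, `t ∈ (0,T]`: the densities `m̄ ∈ W^{2,∞}(ℝⁿ)` supported in `Ω̃(t)` with
`‖m(·,s;α,m̄,t)‖_{W^{2,∞}} ≤ K` for all `s ∈ [t,T]` and `α ∈ 𝒜`. -/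
def stateSet {n : ℕ} (T M K : ℝ) (Om' : Set (Rn n)) (t : ℝ) : Set (Rn n → ℝ) :=
  {m | (Continuous m ∧ wInftyNorm 2 m < ⊤) ∧ tsupport m ⊆ enlarged M Om' t ∧
    ∀ α ∈ admissibleControls n T M, ∀ s ∈ Icc t T,
      wInftyNorm 2 (evolve T α m t s) ≤ ENNReal.ofReal K}

/-- `⟨p, m⟩ = ∫_{Ω̃(T)} p m`, with the weight `p(x) = dist(x, Ω)`. -/
def weightedMass {n : ℕ} (T M : ℝ) (Om' Om : Set (Rn n)) (m : Rn n → ℝ) : ℝ :=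
  ∫ x in enlarged M Om' T, Metric.infDist x Om * m x

/-- `X_c(t) = {m ∈ X(t) : ⟨p, m⟩ < δ}`. -/
def openConstraint {n : ℕ} (T M K δ : ℝ) (Om' Om : Set (Rn n)) (t : ℝ) : Set (Rn n → ℝ) :=
  {m | m ∈ stateSet T M K Om' t ∧ weightedMass T M Om' Om m < δ}

/-- `X̄_c(t) = {m ∈ X(t) : ⟨p, m⟩ ≤ δ}`. -/
def closedConstraint {n : ℕ} (T M K δ : ℝ) (Om' Om : Set (Rn n)) (t : ℝ) : Set (Rn n → ℝ) :=
  {m | m ∈ stateSet T M K Om' t ∧ weightedMass T M Om' Om m ≤ δ}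

/-- The pushback control `a_p(x) = M̄ φ(x) (x_Ω - x)`. -/
def pushback {n : ℕ} (Mbar : ℝ) (φ : Rn n → ℝ) (xOm : Rn n) : Rn n → Rn n :=
  fun x => (Mbar * φ x) • (xOm - x)

/-- The open ball of radius `r` in `L²(ℝⁿ)` around `m₀`, as a set of functions. -/
def ballL2 {n : ℕ} (m₀ : Rn n → ℝ) (r : ℝ) : Set (Rn n → ℝ) :=
  {m | AEStronglyMeasurable m volume ∧ eLpNorm (m - m₀) 2 volume < ENNReal.ofReal r}

end

/-! The field `ζ a_p` points radially at `x_Ω`, so its flow moves each point by a homothety with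
centre `x_Ω` and ratio `exp (-∫ ζ M̄ φ)` along the trajectory (`IsSolutionOn.eq_exp_radial`). As `Ω`
is convex and contains the centre, a ratio at most one contracts the distance to `Ω` by that same
ratio (`Convex.infDist_homothety_le`). During a short time `ε`, trajectories from `Ω̃(T)` stay where
`φ ≥ 1/2`, so the ratio is at most `exp (-ζ M̄ ε / 2) ≤ 1 - ζ M̄ ε / 4`.

A non-negative density is carried along the flow, so its weighted mass shrinks by this factor
(`weightedMass_evolve_le`) and drops from at most `δ` to at most `δ - ζ ε M̄ δ / 4`. An `L²`
perturbation of size `ζ ε B` changes the weighted mass by at most `P ζ ε B`, with `P` a bound for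
`p` on `Ω̃(T)` times the square root of the volume (`integral_mul_le_of_eLpNorm_two`). Gain and loss
both scale like `ζ ε`, so one `B` with `P B < M̄ δ / 4` serves all `ζ` and `ε`. -/

/-! ### Solutions of autonomous equations with a bounded Lipschitz field -/

/-- `γ` solves `γ' = v(γ)` on `[a,b]`, with one-sided derivatives at the end points. -/
def IsSolutionOn {E : Type*} [NormedAddCommGroup E] [NormedSpace ℝ E] (v : E → E) (a b : ℝ)
    (γ : ℝ → E) : Prop :=
  ∀ s ∈ Icc a b, HasDerivWithinAt γ (v (γ s)) (Icc a b) s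

section Solutions

variable {E : Type*} [NormedAddCommGroup E] [NormedSpace ℝ E] {v : E → E} {C : NNReal}
  {a b : ℝ} {γ γ' : ℝ → E}

theorem IsSolutionOn.continuousOn (h : IsSolutionOn v a b γ) : ContinuousOn γ (Icc a b) :=
  fun s hs => (h s hs).continuousWithinAt

theorem IsSolutionOn.mono {a' b' : ℝ} (h : IsSolutionOn v a b γ) (ha : a ≤ a') (hb : b' ≤ b) :
    IsSolutionOn v a' b' γ :=
  fun s hs => (h s (Icc_subset_Icc ha hb hs)).mono (Icc_subset_Icc ha hb)

theorem IsSolutionOn.hasDerivWithinAt_Ici (h : IsSolutionOn v a b γ) {s : ℝ} (hs : s ∈ Ico a b) :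
    HasDerivWithinAt γ (v (γ s)) (Ici s) s :=
  (h s (Ico_subset_Icc_self hs)).mono_of_mem_nhdsWithin (Icc_mem_nhdsGE_of_mem hs)

theorem IsSolutionOn.hasDerivWithinAt_Iic (h : IsSolutionOn v a b γ) {s : ℝ} (hs : s ∈ Ioc a b) :
    HasDerivWithinAt γ (v (γ s)) (Iic s) s :=
  (h s (Ioc_subset_Icc_self hs)).mono_of_mem_nhdsWithin (Icc_mem_nhdsLE_of_mem hs)

/-- Boundedness of the field makes a Picard–Lindelöf ball large enough for the whole interval. The
data may be prescribed at any time in `[a,b]`, which later allows solving backwards. -/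
theorem exists_isSolutionOn [CompleteSpace E] (hv : LipschitzWith C v) {L : NNReal}
    (hL : ∀ x, ‖v x‖ ≤ L) {t : ℝ} (ht : t ∈ Icc a b) (y : E) :
    ∃ γ, γ t = y ∧ IsSolutionOn v a b γ := by
  set r : NNReal := L * (max (b - t) (t - a)).toNNReal
  have hpl : IsPicardLindelof (fun _ => v) (⟨t, ht⟩ : Icc a b) y r 0 L C := by
    refine .of_time_independent (fun x _ => hL x) hv.lipschitzOnWith ?_
    have : 0 ≤ max (b - t) (t - a) := le_max_of_le_left (sub_nonneg.2 ht.2)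
    simp [r, Real.coe_toNNReal _ this]
  exact hpl.exists_eq_forall_mem_Icc_hasDerivWithinAt₀

theorem IsSolutionOn.dist_le (hv : LipschitzWith C v) (h : IsSolutionOn v a b γ)
    (h' : IsSolutionOn v a b γ') {s : ℝ} (hs : s ∈ Icc a b) :
    dist (γ s) (γ' s) ≤ dist (γ a) (γ' a) * Real.exp (C * (s - a)) :=
  dist_le_of_trajectories_ODE (v := fun _ => v) (fun _ => hv) h.continuousOn
    (fun _ hr => h.hasDerivWithinAt_Ici hr) h'.continuousOn
    (fun _ hr => h'.hasDerivWithinAt_Ici hr) le_rfl s hs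

theorem IsSolutionOn.eq_of_eq_left (hv : LipschitzWith C v) (h : IsSolutionOn v a b γ)
    (h' : IsSolutionOn v a b γ') (ha : γ a = γ' a) {s : ℝ} (hs : s ∈ Icc a b) : γ s = γ' s := by
  have := h.dist_le hv h' hs
  rw [ha, dist_self, zero_mul] at this
  exact dist_le_zero.1 this

theorem IsSolutionOn.eq_of_eq_right (hv : LipschitzWith C v) (h : IsSolutionOn v a b γ)
    (h' : IsSolutionOn v a b γ') (hb : γ b = γ' b) {s : ℝ} (hs : s ∈ Icc a b) : γ s = γ' s :=
  ODE_solution_unique_of_mem_Icc_left (v := fun _ => v) (s := fun _ => univ)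
    (fun _ _ => hv.lipschitzOnWith) h.continuousOn (fun _ hr => h.hasDerivWithinAt_Iic hr)
    (fun _ _ => trivial) h'.continuousOn (fun _ hr => h'.hasDerivWithinAt_Iic hr)
    (fun _ _ => trivial) hb hs

theorem IsSolutionOn.dist_left_le {L : NNReal} (hL : ∀ x, ‖v x‖ ≤ L) (h : IsSolutionOn v a b γ)
    {s : ℝ} (hs : s ∈ Icc a b) : dist (γ s) (γ a) ≤ L * (s - a) := by
  have hab : a ≤ b := hs.1.trans hs.2
  have := (convex_Icc a b).norm_image_sub_le_of_norm_hasDerivWithin_le (f := γ)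
    (f' := fun r => v (γ r)) h (fun r _ => hL _) (left_mem_Icc.2 hab) hs
  rwa [dist_eq_norm, ← Real.norm_of_nonneg (sub_nonneg.2 hs.1)]

/-- A field `x ↦ c(x) (x₀ - x)` contracts its solutions radially towards `x₀`. -/
theorem IsSolutionOn.eq_exp_radial {c : E → ℝ} (hc : Continuous c) {x₀ : E}
    (h : IsSolutionOn (fun x => c x • (x₀ - x)) a b γ) (hab : a ≤ b) :
    γ b = x₀ + Real.exp (-∫ r in a..b, c (γ r)) • (γ a - x₀) := by
  -- `γ` is controlled only on `[a,b]`; its constant extension is continuous on the whole line, so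
  -- the primitive `G` is differentiable everywhere.
  set Γ : ℝ → E := IccExtend hab ((Icc a b).domRestrict γ)
  have hΓ : Continuous Γ := (continuousOn_iff_continuous_domRestrict.1 h.continuousOn).Icc_extend'
  have hΓγ : ∀ s ∈ Icc a b, Γ s = γ s := fun s hs => IccExtend_of_mem hab _ hs
  set G : ℝ → ℝ := fun s => ∫ r in a..s, c (Γ r)
  have hG : ∀ s, HasDerivAt G (c (Γ s)) s := fun s =>
    intervalIntegral.integral_hasDerivAt_right ((hc.comp hΓ).intervalIntegrable _ _)
      ((hc.comp hΓ).stronglyMeasurableAtFilter _ _) (hc.comp hΓ).continuousAt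
  -- `exp G` is the integrating factor of `(γ - x₀)' = -c(γ) (γ - x₀)`.
  have hw : ∀ s ∈ Icc a b,
      HasDerivWithinAt (fun s => Real.exp (G s) • (γ s - x₀)) 0 (Icc a b) s := by
    intro s hs
    have h1 := ((hG s).exp.hasDerivWithinAt (s := Icc a b)).smul ((h s hs).sub_const x₀)
    rw [hΓγ s hs] at h1
    refine h1.congr_deriv ?_
    rw [smul_smul, ← neg_sub (γ s) x₀, smul_neg, neg_add_cancel]
  have hconst := constant_of_has_deriv_right_zero (fun s hs => (hw s hs).continuousWithinAt)
    (fun s hs => (hw s (Ico_subset_Icc_self hs)).mono_of_mem_nhdsWithin (Icc_mem_nhdsGE_of_mem hs))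
    b (right_mem_Icc.2 hab)
  have hGa : G a = 0 := intervalIntegral.integral_same
  have hGb : G b = ∫ r in a..b, c (γ r) :=
    intervalIntegral.integral_congr fun r hr => by
      rw [uIcc_of_le hab] at hr
      simp only [hΓγ r hr]
  rw [hGa, Real.exp_zero, one_smul, hGb] at hconst
  rw [← hconst, smul_smul, ← Real.exp_add, neg_add_cancel, Real.exp_zero, one_smul,
    add_sub_cancel]

end Solutions

/-! ### The flow of an autonomous bounded Lipschitz field -/

section Flow

variable {n : ℕ} {T t : ℝ} {v : Rn n → Rn n} {C L : NNReal}

theorem isTrajectory_iff (hv : Continuous v) (ht : t ≤ T) {x : Rn n} {γ : ℝ → Rn n} :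
    IsTrajectory T (fun _ => v) t x γ ↔ γ t = x ∧ IsSolutionOn v t T γ := by
  have hint : ContinuousOn γ (Icc t T) → ∀ s ∈ Icc t T,
      IntervalIntegrable (fun r => v (γ r)) volume t s := fun hγ s hs =>
    ((hv.comp_continuousOn hγ).mono
      (by rw [uIcc_of_le hs.1]; exact Icc_subset_Icc_right hs.2)).intervalIntegrable
  constructor
  · rintro ⟨hγ, h⟩
    have h0 : γ t = x := by simpa using (h t (left_mem_Icc.2 ht)).2
    refine ⟨h0, fun s hs => ?_⟩
    have := ODE.hasDerivWithinAt_picard_Icc (f := fun _ => v) (u := univ) (left_mem_Icc.2 ht)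
      (hv.comp continuous_snd).continuousOn hγ (fun _ _ => trivial) x hs
    exact this.congr (fun r hr => (h r hr).2) (h s hs).2
  · rintro ⟨h0, h⟩
    refine ⟨h.continuousOn, fun s hs => ⟨hint h.continuousOn s hs, ?_⟩⟩
    have hs' := h.mono le_rfl hs.2
    rw [intervalIntegral.integral_eq_sub_of_hasDeriv_right_of_le hs.1 hs'.continuousOn
      (fun r hr => (hs'.hasDerivWithinAt_Ici (Ioo_subset_Ico_self hr)).mono Ioi_subset_Ici_self)
      (hint h.continuousOn s hs), h0, add_sub_cancel]

theorem exists_isSolutionOn_flow (hv : LipschitzWith C v) (hL : ∀ x, ‖v x‖ ≤ L) (ht : t ≤ T)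
    (x : Rn n) :
    ∃ γ, γ t = x ∧ IsSolutionOn v t T γ ∧ ∀ s, flow T (fun _ => v) t s x = γ s := by
  have h : ∃ γ, IsTrajectory T (fun _ => v) t x γ := by
    simpa only [isTrajectory_iff hv.continuous ht] using
      exists_isSolutionOn hv hL (left_mem_Icc.2 ht) x
  have h' := (isTrajectory_iff hv.continuous ht).1 h.choose_spec
  exact ⟨h.choose, h'.1, h'.2, fun s => dif_pos h⟩

theorem lipschitzWith_flow (hv : LipschitzWith C v) (hL : ∀ x, ‖v x‖ ≤ L) {s : ℝ}
    (hs : s ∈ Icc t T) : ∃ C', LipschitzWith C' (flow T (fun _ => v) t s) := by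
  refine ⟨(Real.exp (C * (s - t))).toNNReal, LipschitzWith.of_dist_le_mul fun x y => ?_⟩
  obtain ⟨γ, h0, h, hf⟩ := exists_isSolutionOn_flow hv hL (hs.1.trans hs.2) x
  obtain ⟨γ', h0', h', hf'⟩ := exists_isSolutionOn_flow hv hL (hs.1.trans hs.2) y
  rw [hf, hf', Real.coe_toNNReal _ (Real.exp_pos _).le, mul_comm, ← h0, ← h0']
  exact h.dist_le hv h' hs

/-- Injectivity is backward uniqueness; a preimage of `y` is the value at time `t` of the solution
that passes through `y` at time `s`. -/
theorem bijective_flow (hv : LipschitzWith C v) (hL : ∀ x, ‖v x‖ ≤ L) {s : ℝ}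
    (hs : s ∈ Icc t T) : Function.Bijective (flow T (fun _ => v) t s) := by
  have ht := hs.1.trans hs.2
  constructor
  · intro x y hxy
    obtain ⟨γ, h0, h, hf⟩ := exists_isSolutionOn_flow hv hL ht x
    obtain ⟨γ', h0', h', hf'⟩ := exists_isSolutionOn_flow hv hL ht y
    rw [hf, hf'] at hxy
    rw [← h0, ← h0']
    exact (h.mono le_rfl hs.2).eq_of_eq_right hv (h'.mono le_rfl hs.2) hxy (left_mem_Icc.2 hs.1)
  · intro y
    obtain ⟨γ, h0, h⟩ := exists_isSolutionOn hv hL hs y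
    obtain ⟨γ', h0', h', hf'⟩ := exists_isSolutionOn_flow hv hL ht (γ t)
    exact ⟨γ t, by rw [hf', h'.eq_of_eq_left hv h h0' hs, h0]⟩

end Flow

/-! ### Transport of densities along Lipschitz bijections -/

section Transport

/-- Lipschitz self-maps of a finite-dimensional space send null sets to null sets. -/
theorem LipschitzWith.measure_image_eq_zero {E : Type*} [NormedAddCommGroup E] [NormedSpace ℝ E]
    [FiniteDimensional ℝ E] [MeasurableSpace E] [BorelSpace E] (μ : Measure E)
    [μ.IsAddHaarMeasure] {C : NNReal} {f : E → E} (hf : LipschitzWith C f) {s : Set E}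
    (hs : μ s = 0) : μ (f '' s) = 0 := by
  have h1 : Measure.hausdorffMeasure (Module.finrank ℝ E : ℝ) s = 0 :=
    Measure.absolutelyContinuous_isAddHaarMeasure _ μ hs
  have h2 := hf.hausdorffMeasure_image_le (Nat.cast_nonneg (Module.finrank ℝ E)) s
  rw [h1, mul_zero, nonpos_iff_eq_zero] at h2
  exact Measure.absolutelyContinuous_isAddHaarMeasure μ _ h2

/-- Change of variables along a Lipschitz bijection, through its almost everywhere derivative. -/
theorem LipschitzWith.lintegral_comp_abs_det {E : Type*} [NormedAddCommGroup E] [NormedSpace ℝ E]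
    [FiniteDimensional ℝ E] [MeasurableSpace E] [BorelSpace E] (μ : Measure E)
    [μ.IsAddHaarMeasure] {C : NNReal} {f : E → E} (hf : LipschitzWith C f)
    (hbij : Function.Bijective f) (g : E → ℝ≥0∞) :
    ∫⁻ y, g y ∂μ = ∫⁻ x, ENNReal.ofReal |(fderiv ℝ f x).det| * g (f x) ∂μ := by
  -- By Rademacher's theorem the complement of `D` is null, and so is its Lipschitz image; the
  -- change of variables can be made on `D` alone.
  set D := {x | DifferentiableAt ℝ f x}
  have hD : MeasurableSet D := measurableSet_of_differentiableAt ℝ f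
  have hDc : μ Dᶜ = 0 := hf.ae_differentiableAt
  have himg : μ (f '' D)ᶜ = 0 := by
    rw [← image_compl_eq hbij]
    exact hf.measure_image_eq_zero μ hDc
  rw [← setLIntegral_univ g, ← setLIntegral_univ (fun x => _ * _),
    ← setLIntegral_congr (ae_eq_univ.2 himg), ← setLIntegral_congr (ae_eq_univ.2 hDc)]
  exact lintegral_image_eq_lintegral_abs_det_fderiv_mul μ hD
    (fun x hx => DifferentiableAt.hasFDerivAt hx |>.hasFDerivWithinAt) hbij.1.injOn g

end Transport

/-! ### Weighted mass of evolved densities -/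

section Evolve

variable {n : ℕ} {T t s : ℝ} {v : Rn n → Rn n} {C L : NNReal}

theorem flowInv_flow (hv : LipschitzWith C v) (hL : ∀ x, ‖v x‖ ≤ L) (hs : s ∈ Icc t T) (x : Rn n) :
    flowInv T (fun _ => v) t s (flow T (fun _ => v) t s x) = x :=
  Function.leftInverse_invFun (bijective_flow hv hL hs).1 x

/-- Preimages under the inverse are images under the flow, and a continuous injection maps Borel
sets to Borel sets (Lusin–Souslin). -/
theorem measurable_flowInv (hv : LipschitzWith C v) (hL : ∀ x, ‖v x‖ ≤ L) (hs : s ∈ Icc t T) :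
    Measurable (flowInv T (fun _ => v) t s) := by
  obtain ⟨C', hC'⟩ := lipschitzWith_flow hv hL hs
  have hbij := bijective_flow hv hL hs
  intro A hA
  have : flowInv T (fun _ => v) t s ⁻¹' A = flow T (fun _ => v) t s '' A :=
    (congrFun (image_eq_preimage_of_inverse (Function.leftInverse_invFun hbij.1)
      (Function.rightInverse_invFun hbij.2)) A).symm
  rw [this]
  exact (hC'.continuous.measurableEmbedding hbij.1).measurableSet_image.2 hA

theorem measurable_evolve (hv : LipschitzWith C v) (hL : ∀ x, ‖v x‖ ≤ L) (hs : s ∈ Icc t T)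
    {m : Rn n → ℝ} (hm : Measurable m) : Measurable (evolve T (fun _ => v) m t s) := by
  have hΨ := measurable_flowInv hv hL hs
  have hdet : Measurable fun x => (fderiv ℝ (flow T (fun _ => v) t s) x).det :=
    ContinuousLinearMap.continuous_det.measurable.comp (measurable_fderiv ℝ _)
  exact (hm.comp hΨ).div (hdet.comp hΨ)

/-- The Jacobian of the change of variables cancels the denominator. Where the determinant vanishes,
division by zero makes the evolved density `0`, so the inequality survives without showing that the
Jacobian is nonzero. -/
theorem lintegral_evolve_le (hv : LipschitzWith C v) (hL : ∀ x, ‖v x‖ ≤ L) (hs : s ∈ Icc t T)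
    {m : Rn n → ℝ} (hm : ∀ x, 0 ≤ m x) (w : Rn n → ℝ≥0∞) :
    ∫⁻ y, w y * ENNReal.ofReal |evolve T (fun _ => v) m t s y| ≤
      ∫⁻ x, w (flow T (fun _ => v) t s x) * ENNReal.ofReal (m x) := by
  obtain ⟨C', hC'⟩ := lipschitzWith_flow hv hL hs
  rw [hC'.lintegral_comp_abs_det volume (bijective_flow hv hL hs)]
  refine lintegral_mono fun x => ?_
  rw [mul_left_comm, ← ENNReal.ofReal_mul (abs_nonneg _)]
  gcongr
  rw [evolve, flowInv_flow hv hL hs, abs_div, abs_of_nonneg (hm x)]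
  rcases eq_or_ne |(fderiv ℝ (flow T (fun _ => v) t s) x).det| 0 with h | h
  · simpa [h] using hm x
  · exact (mul_div_cancel₀ (m x) h).le

end Evolve

/-! ### The pushback field -/

section Pushback

/-- The homothety maps `S` into itself and scales distances by `l`, so near-optimal points of `S` go
to competitors in `S`. -/
theorem Convex.infDist_homothety_le {E : Type*} [NormedAddCommGroup E] [NormedSpace ℝ E]
    {S : Set E} (hS : Convex ℝ S) {x₀ : E} (hx₀ : x₀ ∈ S) {l : ℝ} (hl : 0 ≤ l) (hl1 : l ≤ 1)
    (x : E) : Metric.infDist (x₀ + l • (x - x₀)) S ≤ l * Metric.infDist x S := by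
  refine le_of_forall_pos_le_add fun e he => ?_
  obtain ⟨y, hy, hxy⟩ := (Metric.infDist_lt_iff ⟨x₀, hx₀⟩).1 (lt_add_of_pos_right _ he)
  have hy' : x₀ + l • (y - x₀) ∈ S := hS.add_smul_sub_mem hx₀ hy ⟨hl, hl1⟩
  calc Metric.infDist (x₀ + l • (x - x₀)) S
      ≤ dist (x₀ + l • (x - x₀)) (x₀ + l • (y - x₀)) := Metric.infDist_le_dist_of_mem hy'
    _ = l * dist x y := by
      rw [dist_add_left, dist_smul₀, dist_sub_right, Real.norm_of_nonneg hl]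
    _ ≤ l * (Metric.infDist x S + e) := by gcongr
    _ ≤ l * Metric.infDist x S + e := by nlinarith

variable {n : ℕ} {Mbar : ℝ} {φ : Rn n → ℝ} {xOm : Rn n}

theorem contDiff_pushback (hφ : ContDiff ℝ ∞ φ) : ContDiff ℝ ∞ (pushback Mbar φ xOm) := by
  unfold pushback
  fun_prop

theorem hasCompactSupport_pushback (hφ : HasCompactSupport φ) :
    HasCompactSupport (pushback Mbar φ xOm) :=
  (hφ.mul_left (f := fun _ => Mbar)).smul_right (f' := fun x => xOm - x)

/-- Along the flow of `ζ a_p`, the distance to a convex set containing the centre decays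
exponentially, as long as the cut-off stays above `1/2`. -/
theorem infDist_flow_pushback_le {T t s ζ η : ℝ} {C L : NNReal} (hφ : Continuous φ)
    (hMbar : 0 ≤ Mbar) (hζ : 0 ≤ ζ) (hv : LipschitzWith C (ζ • pushback Mbar φ xOm))
    (hL : ∀ x, ‖(ζ • pushback Mbar φ xOm) x‖ ≤ L) (hs : s ∈ Icc t T) (hη : L * (s - t) < η)
    {x : Rn n} (hx : ∀ y, dist y x < η → 1 / 2 ≤ φ y) {S : Set (Rn n)} (hS : Convex ℝ S)
    (hxS : xOm ∈ S) :
    Metric.infDist (flow T (fun _ => ζ • pushback Mbar φ xOm) t s x) S ≤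
      Real.exp (-(ζ * Mbar / 2 * (s - t))) * Metric.infDist x S := by
  obtain ⟨γ, h0, h, hf⟩ := exists_isSolutionOn_flow hv hL (hs.1.trans hs.2) x
  have h' := h.mono le_rfl hs.2
  have heq : ζ • pushback Mbar φ xOm = fun y => (ζ * Mbar * φ y) • (xOm - y) := by
    funext y
    simp only [Pi.smul_apply, pushback, smul_smul, mul_assoc]
  have hc : Continuous fun y => ζ * Mbar * φ y := by fun_prop
  have hγ : γ s = xOm + Real.exp (-∫ r in t..s, ζ * Mbar * φ (γ r)) • (x - xOm) := by
    rw [heq] at h'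
    rw [h'.eq_exp_radial hc hs.1, h0]
  have hint : ζ * Mbar / 2 * (s - t) ≤ ∫ r in t..s, ζ * Mbar * φ (γ r) := by
    have hcont : ContinuousOn (fun r => ζ * Mbar * φ (γ r)) (uIcc t s) := by
      rw [uIcc_of_le hs.1]
      exact hc.comp_continuousOn h'.continuousOn
    have := intervalIntegral.integral_mono_on (μ := volume) (f := fun _ => ζ * Mbar / 2) hs.1
      intervalIntegrable_const hcont.intervalIntegrable fun r hr => by
        -- The speed is at most `L`, so the trajectory cannot leave the ball on which `φ ≥ 1/2`.
        have hd : dist (γ r) x < η := by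
          rw [← h0]
          refine ((h'.dist_left_le hL hr).trans ?_).trans_lt hη
          exact mul_le_mul_of_nonneg_left (by linarith [hr.2]) L.coe_nonneg
        rw [div_eq_mul_one_div]
        exact mul_le_mul_of_nonneg_left (hx _ hd) (mul_nonneg hζ hMbar)
    rwa [intervalIntegral.integral_const, smul_eq_mul, mul_comm] at this
  have hpos : 0 ≤ ζ * Mbar / 2 * (s - t) :=
    mul_nonneg (by positivity) (sub_nonneg.2 hs.1)
  rw [hf, hγ]
  refine (hS.infDist_homothety_le hxS (Real.exp_pos _).le
    (Real.exp_le_one_iff.2 (by linarith)) x).trans ?_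
  exact mul_le_mul_of_nonneg_right (Real.exp_le_exp.2 (by linarith)) Metric.infDist_nonneg

end Pushback

/-! ### The state sets -/

section States

variable {n : ℕ} {M t : ℝ} {Om' : Set (Rn n)}

theorem isCompact_enlarged (hne : Om'.Nonempty) (hb : Bornology.IsBounded Om') :
    IsCompact (enlarged M Om' t) := by
  refine Metric.isCompact_of_isClosed_isBounded
    (isClosed_le (Metric.continuous_infDist_pt _) continuous_const) ?_
  refine (hb.thickening (δ := M * t + 1)).subset fun x hx => ?_
  obtain ⟨y, hy, hxy⟩ := (Metric.infDist_lt_iff hne).1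
    (lt_of_le_of_lt (show Metric.infDist x Om' ≤ M * t from hx) (lt_add_one _))
  exact Metric.mem_thickening_iff.2 ⟨y, hy, hxy⟩

/-- The weighted integral of a function over a set of finite measure is controlled by its
`L²` norm. -/
theorem integral_mul_le_of_eLpNorm_two {X : Type*} [MeasurableSpace X] {μ : Measure X}
    [IsFiniteMeasure μ] {p d : X → ℝ} {P r : ℝ} (hP : 0 ≤ P) (hr : 0 ≤ r)
    (hp : ∀ᵐ x ∂μ, |p x| ≤ P) (hpm : AEStronglyMeasurable p μ)
    (hd : AEStronglyMeasurable d μ) (hdr : eLpNorm d 2 μ ≤ ENNReal.ofReal r) :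
    Integrable (fun x => p x * d x) μ ∧
      ∫ x, p x * d x ∂μ ≤ P * (√(μ.real univ) * r) := by
  have hd2 : MemLp d 2 μ := ⟨hd, hdr.trans_lt ENNReal.ofReal_lt_top⟩
  have hd1 : Integrable d μ := hd2.integrable one_le_two
  have hpd : Integrable (fun x => p x * d x) μ := hd1.bdd_mul hpm hp
  refine ⟨hpd, ?_⟩
  have h1 : ∫ x, |d x| ∂μ ≤ √(μ.real univ) * r := by
    have h := eLpNorm_le_eLpNorm_mul_rpow_measure_univ (p := 1) (q := 2) one_le_two hd
    have h2 : eLpNorm d 2 μ * μ univ ^ (1 / (1 : ℝ≥0∞).toReal - 1 / (2 : ℝ≥0∞).toReal) ≤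
        ENNReal.ofReal (√(μ.real univ) * r) := by
      rw [mul_comm, ENNReal.ofReal_mul (Real.sqrt_nonneg _), Real.sqrt_eq_rpow]
      refine mul_le_mul' ?_ hdr
      rw [← ENNReal.ofReal_rpow_of_nonneg measureReal_nonneg (by norm_num),
        ofReal_measureReal]
      norm_num
    have h3 := ENNReal.toReal_mono ENNReal.ofReal_ne_top (h.trans h2)
    rwa [ENNReal.toReal_ofReal (by positivity), eLpNorm_one_eq_lintegral_enorm,
      ← integral_norm_eq_lintegral_enorm hd] at h3
  calc ∫ x, p x * d x ∂μ ≤ ∫ x, P * |d x| ∂μ := by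
        refine integral_mono_ae hpd (hd1.abs.const_mul P) (hp.mono fun x hx => ?_)
        calc p x * d x ≤ |p x * d x| := le_abs_self _
          _ = |p x| * |d x| := abs_mul _ _
          _ ≤ P * |d x| := mul_le_mul_of_nonneg_right hx (abs_nonneg _)
    _ = P * ∫ x, |d x| ∂μ := integral_const_mul _ _
    _ ≤ _ := mul_le_mul_of_nonneg_left h1 hP

end States

/-- If the flow contracts the weight `dist(·, Ω)` by a factor `l` on a compact set carrying the
initial density, then it contracts the weighted mass by `l`. -/
theorem weightedMass_evolve_le {n : ℕ} {T M t s l : ℝ} {v : Rn n → Rn n} {C L : NNReal}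
    {Om' Om : Set (Rn n)} (hv : LipschitzWith C v) (hL : ∀ x, ‖v x‖ ≤ L) (hs : s ∈ Icc t T)
    (hcomp : IsCompact (enlarged M Om' T)) {m : Rn n → ℝ} (hm : Continuous m)
    (hm0 : ∀ x, 0 ≤ m x) (hsupp : tsupport m ⊆ enlarged M Om' T) (hl : 0 ≤ l)
    (hcontr : ∀ x ∈ enlarged M Om' T,
      Metric.infDist (flow T (fun _ => v) t s x) Om ≤ l * Metric.infDist x Om) :
    weightedMass T M Om' Om (evolve T (fun _ => v) m t s) ≤ l * weightedMass T M Om' Om m := by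
  have hzero : ∀ x, x ∉ enlarged M Om' T → m x = 0 := fun x hx =>
    image_eq_zero_of_notMem_tsupport fun h => hx (hsupp h)
  have hpm : Continuous fun x => Metric.infDist x Om * m x :=
    (Metric.continuous_infDist_pt Om).mul hm
  have hint : Integrable fun x => Metric.infDist x Om * m x :=
    hpm.integrable_of_hasCompactSupport
      (HasCompactSupport.intro hcomp fun x hx => by rw [hzero x hx, mul_zero])
  have hmass : weightedMass T M Om' Om m = ∫ x, Metric.infDist x Om * m x :=
    setIntegral_eq_integral_of_forall_compl_eq_zero fun x hx => by rw [hzero x hx, mul_zero]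
  have hnn : ∀ x, 0 ≤ l * (Metric.infDist x Om * m x) := fun x =>
    mul_nonneg hl (mul_nonneg Metric.infDist_nonneg (hm0 x))
  -- Bounding the lower integral of the norm avoids any integrability claim for the evolved density.
  have key : ∫⁻ y in enlarged M Om' T,
      ENNReal.ofReal ‖Metric.infDist y Om * evolve T (fun _ => v) m t s y‖ ≤
        ENNReal.ofReal (l * weightedMass T M Om' Om m) := by
    calc _ ≤ ∫⁻ y, ENNReal.ofReal ‖Metric.infDist y Om * evolve T (fun _ => v) m t s y‖ :=
          setLIntegral_le_lintegral _ _
      _ = ∫⁻ y, ENNReal.ofReal (Metric.infDist y Om) *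
            ENNReal.ofReal |evolve T (fun _ => v) m t s y| := by
          refine lintegral_congr fun y => ?_
          rw [norm_mul, Real.norm_of_nonneg Metric.infDist_nonneg, Real.norm_eq_abs,
            ENNReal.ofReal_mul Metric.infDist_nonneg]
      _ ≤ ∫⁻ x, ENNReal.ofReal (Metric.infDist (flow T (fun _ => v) t s x) Om) *
            ENNReal.ofReal (m x) := lintegral_evolve_le hv hL hs hm0 _
      _ ≤ ∫⁻ x, ENNReal.ofReal (l * (Metric.infDist x Om * m x)) := by
          refine lintegral_mono fun x => ?_
          rw [← ENNReal.ofReal_mul Metric.infDist_nonneg]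
          refine ENNReal.ofReal_le_ofReal ?_
          by_cases hx : x ∈ enlarged M Om' T
          · rw [← mul_assoc]
            exact mul_le_mul_of_nonneg_right (hcontr x hx) (hm0 x)
          · simp [hzero x hx]
      _ = ENNReal.ofReal (l * weightedMass T M Om' Om m) := by
          rw [hmass, ← integral_const_mul]
          exact (ofReal_integral_eq_lintegral_ofReal (hint.const_mul l)
            (Eventually.of_forall hnn)).symm
  have hnn' : 0 ≤ l * weightedMass T M Om' Om m := by
    rw [hmass, ← integral_const_mul]
    exact integral_nonneg hnn
  refine (Real.le_norm_self _).trans ((norm_integral_le_lintegral_norm _).trans ?_)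
  exact (ENNReal.toReal_mono ENNReal.ofReal_ne_top key).trans_eq (ENNReal.toReal_ofReal hnn')

/-- Invert `exp y ≥ 1 + y` and use `(1 + y) (1 - y / 2) ≥ 1` on `[0,1]`. -/
theorem exp_neg_le_one_sub_half {y : ℝ} (hy : 0 ≤ y) (hy1 : y ≤ 1) :
    Real.exp (-y) ≤ 1 - y / 2 := by
  rw [Real.exp_neg]
  refine inv_le_of_inv_le₀ (by linarith) ?_
  refine le_trans ?_ (Real.add_one_le_exp y)
  rw [inv_le_iff_one_le_mul₀ (by linarith)]
  nlinarith

theorem mainTheorem7 (n : ℕ) (T M K δ : ℝ) (hT : 0 < T) (hM : 0 < M) (hK : 0 < K) (hδ : 0 < δ)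
    (Om' Om : Set (Rn n)) (hOm'_open : IsOpen Om') (hOm'_bdd : Bornology.IsBounded Om')
    (hOm_open : IsOpen Om) (hOm_conv : Convex ℝ Om) (hOm_sub : Om ⊆ Om')
    (xOm : Rn n) (hxOm : xOm ∈ Om)
    (φ : Rn n → ℝ) (hφ_smooth : ContDiff ℝ ∞ φ)
    (hφ_one : ∀ x ∈ closure (enlarged M Om' T), φ x = 1)
    (ρ : ℝ) (hρ : 0 < ρ)
    (hφ_zero : ∀ x, ρ ≤ Metric.infDist x (enlarged M Om' T) → φ x = 0)
    (Mbar : ℝ) (hMbar : 0 < Mbar) (hap : pushback Mbar φ xOm ∈ admissibleFields n M) :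
    ∃ B : ℝ, 0 < B ∧
      ∀ mbar ∈ closedConstraint T M K δ Om' Om T, (∀ x, 0 ≤ mbar x) →
        ∀ tbar ∈ Ico 0 T, ∀ ζ ∈ Ioc (0 : ℝ) 1, ∀ ε ∈ Ioc 0 (min B (T - tbar)),
          closedConstraint T M K δ Om' Om T ∩
              ballL2 (evolve T (fun _ => ζ • pushback Mbar φ xOm) mbar tbar (tbar + ε)) (ζ * ε * B)
            ⊆ openConstraint T M K δ Om' Om T := by
  set A := enlarged M Om' T with hA
  have hcomp : IsCompact A := isCompact_enlarged ⟨xOm, hOm_sub hxOm⟩ hOm'_bdd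
  have hne : A.Nonempty := ⟨xOm, by
    simpa [hA, enlarged, Metric.infDist_zero_of_mem (hOm_sub hxOm)] using (mul_pos hM hT).le⟩
  have hφ_supp : HasCompactSupport φ := by
    refine HasCompactSupport.intro (hcomp.cthickening (r := ρ)) fun x hx => hφ_zero x ?_
    by_contra! h
    obtain ⟨y, hy, hxy⟩ := (Metric.infDist_lt_iff hne).1 h
    exact hx (Metric.mem_cthickening_of_dist_le x y ρ A hy hxy.le)
  have hpb_supp := hasCompactSupport_pushback (Mbar := Mbar) (xOm := xOm) hφ_supp
  have hpb := contDiff_pushback (Mbar := Mbar) (xOm := xOm) hφ_smooth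
  obtain ⟨Cφ, hCφ⟩ := hφ_smooth.lipschitzWith_of_hasCompactSupport hφ_supp (by simp)
  obtain ⟨C, hC⟩ := hpb.lipschitzWith_of_hasCompactSupport hpb_supp (by simp)
  obtain ⟨L₀, hL₀⟩ := hpb_supp.exists_bound_of_continuous hpb.continuous
  obtain ⟨L, hL⟩ : ∃ L : NNReal, ∀ x, ‖pushback Mbar φ xOm x‖ ≤ L :=
    ⟨L₀.toNNReal, fun x => (hL₀ x).trans (Real.le_coe_toNNReal _)⟩
  obtain ⟨P₀, hP₀⟩ := hcomp.exists_bound_of_continuousOn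
    (Metric.continuous_infDist_pt Om).continuousOn
  have hP₀_nonneg : 0 ≤ P₀ := (norm_nonneg _).trans (hP₀ _ hne.some_mem)
  set P := P₀ * √((volume.restrict A).real univ)
  have hP : 0 ≤ P := mul_nonneg hP₀_nonneg (Real.sqrt_nonneg _)
  -- Since `φ = 1` on `A` and `φ` is `Cφ`-Lipschitz, it drops by at most `1/2` within distance `η`;
  -- the `+ 1` guards against `Cφ = 0`.
  set η : ℝ := 1 / (2 * (Cφ + 1))
  have hη : 0 < η := by positivity
  have hφ_half : ∀ x ∈ A, ∀ y, dist y x < η → 1 / 2 ≤ φ y := by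
    intro x hx y hy
    have h1 : |φ y - 1| ≤ Cφ * dist y x := by
      simpa [hφ_one x (subset_closure hx), Real.dist_eq] using hCφ.dist_le_mul y x
    have h2 : Cφ * dist y x ≤ (Cφ + 1) * η :=
      mul_le_mul (by simp) hy.le dist_nonneg (by positivity)
    have h3 : (Cφ + 1) * η = 1 / 2 := by
      simp only [η]
      field_simp
    linarith [(abs_le.1 h1).1]
  -- The three bounds keep trajectories within `η` of their start, keep the exponent `ζ M̄ ε / 2` at
  -- most `1`, and force `P B < M̄ δ / 4`.
  refine ⟨min (min (η / (L + 1)) (2 / Mbar)) (Mbar * δ / (4 * (P + 1))), by positivity, ?_⟩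
  set B := min (min (η / (L + 1)) (2 / Mbar)) (Mbar * δ / (4 * (P + 1)))
  intro mbar hmbar hmbar0 tbar htbar ζ hζ ε hε m ⟨hm, _, hball⟩
  refine ⟨hm.1, ?_⟩
  have hεB : ε ≤ B := hε.2.trans (min_le_left _ _)
  have hs : tbar + ε ∈ Icc tbar T :=
    ⟨by linarith [hε.1], by linarith [hε.2.trans (min_le_right _ _)]⟩
  have hLε : L * (tbar + ε - tbar) < η := by
    have h := hεB.trans ((min_le_left _ _).trans (min_le_left _ _))
    rw [le_div_iff₀ (by positivity)] at h
    rw [add_sub_cancel_left]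
    nlinarith [hε.1]
  have hMε : Mbar * ε ≤ 2 := by
    have h := hεB.trans ((min_le_left _ _).trans (min_le_right _ _))
    rwa [le_div_iff₀ hMbar, mul_comm] at h
  have hPB : P * B < Mbar * δ / 4 := by
    have h : B ≤ Mbar * δ / (4 * (P + 1)) := min_le_right _ _
    rw [le_div_iff₀ (by positivity)] at h
    have hB : 0 < B := hε.1.trans_le hεB
    nlinarith
  have hv : LipschitzWith (‖ζ‖₊ * C) (ζ • pushback Mbar φ xOm) :=
    (lipschitzWith_smul ζ).comp hC
  -- `ζ ≤ 1` lets one speed bound `L` serve all `ζ`, so that `B` does not depend on `ζ`.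
  have hvL : ∀ x, ‖(ζ • pushback Mbar φ xOm) x‖ ≤ L := fun x => by
    rw [Pi.smul_apply, norm_smul, Real.norm_of_nonneg hζ.1.le]
    exact (mul_le_of_le_one_left (norm_nonneg _) hζ.2).trans (hL x)
  set m₀ := evolve T (fun _ => ζ • pushback Mbar φ xOm) mbar tbar (tbar + ε)
  set y := ζ * Mbar / 2 * ε
  have hmass : weightedMass T M Om' Om m₀ ≤ Real.exp (-y) * weightedMass T M Om' Om mbar := by
    refine weightedMass_evolve_le hv hvL hs hcomp hmbar.1.1.1 hmbar0 hmbar.1.2.1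
      (Real.exp_pos _).le fun x hx => ?_
    have := infDist_flow_pushback_le hφ_smooth.continuous hMbar.le hζ.1.le hv hvL hs hLε
      (hφ_half x hx) hOm_conv hxOm
    rwa [add_sub_cancel_left] at this
  have hy : 0 ≤ y := by have := hζ.1; have := hε.1; positivity
  have hy1 : y ≤ 1 := by
    have h : ζ * (Mbar * ε) ≤ 1 * 2 :=
      mul_le_mul hζ.2 hMε (mul_nonneg hMbar.le hε.1.le) zero_le_one
    simp only [y]
    linarith
  have hmass' : weightedMass T M Om' Om m₀ ≤ (1 - y / 2) * δ :=
    hmass.trans ((mul_le_mul_of_nonneg_left hmbar.2 (Real.exp_pos _).le).trans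
      (mul_le_mul_of_nonneg_right (exp_neg_le_one_sub_half hy hy1) hδ.le))
  have hm_cont : Continuous m := hm.1.1.1
  have hm₀_meas : Measurable m₀ := measurable_evolve hv hvL hs hmbar.1.1.1.measurable
  have hp_cont : Continuous fun x : Rn n => Metric.infDist x Om := Metric.continuous_infDist_pt Om
  have hfin : IsFiniteMeasure (volume.restrict A) :=
    isFiniteMeasure_restrict.2 hcomp.measure_lt_top.ne
  have hr : 0 ≤ ζ * ε * B :=
    mul_nonneg (mul_nonneg hζ.1.le hε.1.le) (hε.1.le.trans hεB)
  obtain ⟨hdiff_int, hdiff⟩ := integral_mul_le_of_eLpNorm_two (μ := volume.restrict A)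
    (p := fun x => Metric.infDist x Om) (d := m - m₀) hP₀_nonneg hr
    ((ae_restrict_mem hcomp.measurableSet).mono fun x hx => hP₀ x hx)
    hp_cont.aestronglyMeasurable
    (hm_cont.measurable.sub hm₀_meas).aestronglyMeasurable
    ((eLpNorm_mono_measure _ Measure.restrict_le_self).trans hball.le)
  have hm_int : IntegrableOn (fun x => Metric.infDist x Om * m x) A :=
    (hp_cont.mul hm_cont).continuousOn.integrableOn_compact hcomp
  have hsub : weightedMass T M Om' Om m - weightedMass T M Om' Om m₀ =
      ∫ x in A, Metric.infDist x Om * (m - m₀) x := by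
    -- Integrability for `m₀` is inferred from that for `m` and for the `L²` difference.
    have hm₀_int : IntegrableOn (fun x => Metric.infDist x Om * m₀ x) A := by
      refine (hm_int.sub hdiff_int).congr (Eventually.of_forall fun x => ?_)
      simp only [Pi.sub_apply]
      ring
    rw [weightedMass, weightedMass, ← integral_sub hm_int hm₀_int]
    refine integral_congr_ae (Eventually.of_forall fun x => ?_)
    simp only [Pi.sub_apply]
    ring
  have hfinal : P₀ * (√((volume.restrict A).real univ) * (ζ * ε * B)) < ζ * ε * (Mbar * δ / 4) := by
    calc _ = ζ * ε * (P * B) := by simp only [P]; ring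
      _ < _ := mul_lt_mul_of_pos_left hPB (mul_pos hζ.1 hε.1)
  have hy2 : (1 - y / 2) * δ = δ - ζ * ε * (Mbar * δ / 4) := by
    simp only [y]
    ring
  linarith
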